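/- Let $n\ge 0$, let $p_1,\dots,p_n$ be distinct primes, let $B=\mathbb{Z}[\tfrac1{p_1p_2\cdots p_n}]$ (as an additive group), let $A$ be the free group on $a_1,\dots,a_n$, and let $\varphi:A\to\mathrm{Aut}(B)$ be the homomorphism for which $\varphi(a_i)$ is multiplication by $\tfrac1{p_i}$. Put $G=B\rtimes_\varphi A$. Let $T$ be the Cayley graph of $A$ with respect to $\{a_1,\dots,a_n\}$, regarded as a metric tree with edges of length one, and let $\rho:G\to\mathrm{Isom}(T)$ be the action obtained by composing the projection $G\to A$ with the action of $A$ on $T$ by left translations. The boundary $\partial T$ is the set of geodesic rays $\tau:[0,\infty)\to T$ with $\tau(0)=1$; each of them corresponds to a unique infinite reduced word $c_1c_2c_3\cdots$ in the letters $a_i^{\pm1}$ with $\tau(m)=c_1c_2\cdots c_m$ for all integers $m\ge 0$. For $t\in\mathbb{R}$ let $HB_t(\tau)=\bigcup_{l\ge\max\{0,t\}}\{x\in T: d(x,\tau(l))\le l-t\}$. Recall that $\Sigma^1(\rho)\subseteq\partial T$ is the set of all $\tau$ over which $\rho$ is controlled connected, in the following sense. Let $\tilde X^{(1)}$ be the $1$-skeleton,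 assumed cocompact, of the universal cover of a $K(G,1)$-complex (equivalently, let $\tilde X^{(1)}$ be a non-empty connected free $G$-CW-complex of dimension at most one with finitely many $G$-orbits of cells), and let $h:\tilde X^{(1)}\to T$ be a continuous $G$-map. Let $\tilde X_{(\tau,t)}$ be the largest subcomplex of $\tilde X^{(1)}$ contained in $h^{-1}(HB_t(\tau))$. Then there is a function $\lambda:\mathbb{R}\to[0,\infty)$ with $t-\lambda(t)\to\infty$ as $t\to\infty$ such that, for every $t\in\mathbb{R}$, any two points of $\tilde X_{(\tau,t)}$ can be joined by a path in $\tilde X_{(\tau,t-\lambda(t))}$. (Whether this holds does not depend on the choice of $\tilde X$ and $h$; it is required for some choice.) Then $\Sigma^1(\rho)$ consists exactly of the end points $\tau$ whose infinite reduced word is not eventually constant equal to $a_i^{-1}$ for any $i$: that is, $\tau\in\Sigma^1(\rho)$ if and only if there are no $i\in\{1,\dots,n\}$ and $N$ such that $c_m=a_i^{-1}$ for all $m\ge N$. -/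

import Mathlib

open scoped NNReal unitInterval
open Filter Set

/-! ## The invariant `Σ¹` of an isometric action -/

section Sigma1

universe u v

/-- The boundary of a (proper CAT(0)) metric space `M` with base point `b`: geodesic rays
emanating from `b`. -/
def RayBoundary (M : Type v) [MetricSpace M] (b : M) : Type v :=
  {τ : ℝ≥0 → M // Isometry τ ∧ τ 0 = b}

/-- The horoball `HB_t(τ)`, the nested union of the closed balls of radius `l - t` about `τ(l)`
over `l ≥ max 0 t`; as `t` increases, one approaches `τ(∞)`. -/
def horoball {M : Type v} [MetricSpace M] (τ : ℝ≥0 → M) (t : ℝ) : Set M :=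
  ⋃ (l : ℝ≥0) (_ : t ≤ (l : ℝ)), Metric.closedBall (τ l) ((l : ℝ) - t)

/-- A non-empty connected free `G`-CW-complex of dimension at most one with finitely many orbits
of cells, given by its vertices, its edges and the two attaching maps (loops and multiple edges
are allowed). Since no edge is inverted by a free `G`-CW-action, the orientation of the edges can
be, and is, chosen `G`-invariantly.

These are precisely the cocompact `1`-skeleta of the contractible free `G`-CW-complexes, that is,
of the universal covers of `K(G,1)`-complexes: the `1`-skeleton of a contractible complex is
connected, and to a connected free `G`-graph free `G`-orbits of cells of dimension at least two
can be attached so as to kill all homotopy groups. -/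
structure FreeCocompactGraph (G : Type u) [Group G] where
  /-- the `0`-cells -/
  V : Type u
  /-- the `1`-cells -/
  E : Type u
  /-- the initial vertex of a `1`-cell -/
  src : E → V
  /-- the terminal vertex of a `1`-cell -/
  tgt : E → V
  [actV : MulAction G V]
  [actE : MulAction G E]
  src_smul : ∀ (g : G) (e : E), src (g • e) = g • src e
  tgt_smul : ∀ (g : G) (e : E), tgt (g • e) = g • tgt e
  /-- freeness on `0`-cells; by `src_smul` it implies freeness on `1`-cells -/
  free : ∀ (g : G) (v : V), g • v = v → g = 1
  finite_orbits_V : Finite (MulAction.orbitRel.Quotient G V)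
  finite_orbits_E : Finite (MulAction.orbitRel.Quotient G E)
  nonempty : Nonempty V
  connected : ∀ v w : V, Relation.EqvGen (fun x y => ∃ e : E, src e = x ∧ tgt e = y) v w

attribute [instance] FreeCocompactGraph.actV FreeCocompactGraph.actE

/-- A continuous `G`-map from (the geometric realization of) a free `G`-graph `X` to a space `M` on
which `G` acts by isometries through `ρ`: points of `M` for the vertices and paths in `M` for the
edges, chosen equivariantly. -/
structure EquivariantMap {G : Type u} [Group G] {M : Type v} [MetricSpace M]
    (ρ : G →* (M ≃ᵢ M)) (X : FreeCocompactGraph G) where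
  /-- the map on `0`-cells -/
  vert : X.V → M
  /-- the map on `1`-cells -/
  edge : ∀ e : X.E, Path (vert (X.src e)) (vert (X.tgt e))
  vert_smul : ∀ (g : G) (x : X.V), vert (g • x) = ρ g (vert x)
  edge_smul : ∀ (g : G) (e : X.E) (s : I), edge (g • e) s = ρ g (edge e s)

namespace EquivariantMap

variable {G : Type u} [Group G] {M : Type v} [MetricSpace M] {ρ : G →* (M ≃ᵢ M)}
  {X : FreeCocompactGraph G}

/-- The `0`-cells of the largest subcomplex `X_(τ,t)` contained in `h⁻¹(HB_t(τ))`. -/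
def subV (h : EquivariantMap ρ X) (τ : ℝ≥0 → M) (t : ℝ) : Set X.V :=
  {x | h.vert x ∈ horoball τ t}

/-- The `1`-cells of the largest subcomplex `X_(τ,t)` contained in `h⁻¹(HB_t(τ))`. -/
def subE (h : EquivariantMap ρ X) (τ : ℝ≥0 → M) (t : ℝ) : Set X.E :=
  {e | ∀ s : I, h.edge e s ∈ horoball τ t}

/-- Two `0`-cells are joined by an edge path in the subcomplex `X_(τ,t)`. -/
def JoinedInSub (h : EquivariantMap ρ X) (τ : ℝ≥0 → M) (t : ℝ) (x y : X.V) : Prop :=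
  x ∈ h.subV τ t ∧ y ∈ h.subV τ t ∧
    Relation.EqvGen (fun v w => ∃ e ∈ h.subE τ t, X.src e = v ∧ X.tgt e = w) x y

/-- `h` is controlled connected over `τ(∞)`: there is a lag `lag : ℝ → [0,∞)` with
`t - lag t → ∞` as `t → ∞` such that any two points of `X_(τ,t)` can be connected in
`X_(τ,t - lag t)`. (Every point of `X_(τ,t)` is joined to a `0`-cell inside `X_(τ,t)`, so it is
enough to connect `0`-cells.) -/
def ControlledConnected (h : EquivariantMap ρ X) (τ : ℝ≥0 → M) : Prop :=
  ∃ lag : ℝ → ℝ, (∀ t, 0 ≤ lag t) ∧ Tendsto (fun t => t - lag t) atTop atTop ∧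
    ∀ t, ∀ x ∈ h.subV τ t, ∀ y ∈ h.subV τ t, h.JoinedInSub τ (t - lag t) x y

end EquivariantMap

/-- `Σ¹(ρ)`, the set of the end points of `M` over which `ρ` is controlled connected, as seen on
some choice of a `1`-skeleton `X` and a continuous `G`-map `h : X → M`. (By the invariance theorem
of Bieri and Geoghegan every other choice gives the same set.) -/
def Sigma1 {G : Type u} [Group G] {M : Type v} [MetricSpace M] (ρ : G →* (M ≃ᵢ M)) (b : M) :
    Set (RayBoundary M b) :=
  {τ | ∃ (X : FreeCocompactGraph G) (h : EquivariantMap ρ X), h.ControlledConnected τ.1}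

end Sigma1

/-! ## The geometric realization of a tree -/

section Realization

variable {V : Type*}

/-- The geometric realization of a graph, in barycentric coordinates: the probability weights on
the vertices that are supported on a vertex or on the two ends of an edge. -/
structure Realization (Γ : SimpleGraph V) where
  /-- the barycentric coordinates -/
  coord : V →₀ ℝ
  nonneg : ∀ v, 0 ≤ coord v
  sum_eq_one : (coord.sum fun _ s => s) = 1
  supp : ∃ u v, (u = v ∨ Γ.Adj u v) ∧ ∀ w, coord w ≠ 0 → w = u ∨ w = v

namespace Realization

variable {Γ : SimpleGraph V}

theorem ext_coord {x y : Realization Γ} (h : x.coord = y.coord) : x = y := by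
  cases x; cases y; cases h; rfl

/-- A vertex of the graph as a point of the realization. -/
noncomputable def vertex (Γ : SimpleGraph V) (v : V) : Realization Γ where
  coord := Finsupp.single v 1
  nonneg w := by
    classical
    rw [Finsupp.single_apply]; split_ifs <;> norm_num
  sum_eq_one := by simp
  supp := ⟨v, v, Or.inl rfl, fun w hw => by
    classical
    rw [Finsupp.single_apply] at hw
    by_contra hc
    exact hw (if_neg fun e => hc (Or.inl e.symm))⟩

/-- Functions on the vertices that change by at most one along each edge. -/
def Lip (Γ : SimpleGraph V) : Type _ :=
  {φ : V → ℝ // ∀ u v, Γ.Adj u v → |φ u - φ v| ≤ 1}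

/-- The value at the point `x` of the extension of `φ` to the realization that is affine on every
edge. -/
noncomputable def eval (φ : V → ℝ) (x : Realization Γ) : ℝ :=
  x.coord.sum fun v s => s * φ v

theorem eval_sub_eval (φ : V → ℝ) (x y : Realization Γ) :
    eval φ x - eval φ y = (x.coord - y.coord).sum fun v s => s * φ v := by
  rw [Finsupp.sum_sub_index (by intros; ring)]; rfl

theorem eval_single [DecidableEq V] (x : Realization Γ) (v : V) :
    eval (Pi.single v 1) x = x.coord v := by
  unfold eval
  rw [Finsupp.sum]
  by_cases hv : v ∈ x.coord.support
  · rw [Finset.sum_eq_single v]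
    · simp
    · intro w _ hw; simp [hw]
    · intro h; exact absurd hv h
  · rw [Finset.sum_eq_zero]
    · simpa using (Finsupp.notMem_support_iff.mp hv).symm
    · intro w hw
      have : w ≠ v := fun e => hv (e ▸ hw)
      simp [this]

theorem lip_dist (hΓ : Γ.Connected) (φ : Lip Γ) (u v : V) :
    |φ.1 u - φ.1 v| ≤ Γ.dist u v := by
  obtain ⟨w, hw⟩ := hΓ.exists_walk_length_eq_dist u v
  rw [← hw]
  clear hw
  induction w with
  | nil => simp
  | cons h p ih =>
    have := φ.2 _ _ h
    rw [SimpleGraph.Walk.length_cons]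
    push_cast
    calc _ ≤ _ := abs_sub_le _ _ _
      _ ≤ _ := add_le_add this ih
      _ = _ := add_comm _ _

theorem bddAbove_range (hΓ : Γ.Connected) (x y : Realization Γ) :
    BddAbove (range fun φ : Lip Γ => eval φ.1 x - eval φ.1 y) := by
  obtain ⟨b⟩ := hΓ.nonempty
  have key : ∀ (φ : Lip Γ) (z : Realization Γ),
      |eval φ.1 z - φ.1 b| ≤ z.coord.sum fun v s => s * Γ.dist v b := by
    intro φ z
    have h1 : eval φ.1 z - φ.1 b = z.coord.sum fun v s => s * (φ.1 v - φ.1 b) := by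
      have : φ.1 b = z.coord.sum fun _ s => s * φ.1 b := by
        rw [← Finsupp.sum_mul, z.sum_eq_one, one_mul]
      conv_lhs => rw [this]
      unfold eval Finsupp.sum
      rw [← Finset.sum_sub_distrib]
      exact Finset.sum_congr rfl fun _ _ => by ring
    rw [h1]
    refine (Finset.abs_sum_le_sum_abs _ _).trans (Finset.sum_le_sum fun v _ => ?_)
    rw [abs_mul, abs_of_nonneg (z.nonneg v)]
    exact mul_le_mul_of_nonneg_left (lip_dist hΓ φ v b) (z.nonneg v)
  refine ⟨(x.coord.sum fun v s => s * Γ.dist v b) + (y.coord.sum fun v s => s * Γ.dist v b), ?_⟩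
  rintro _ ⟨φ, rfl⟩
  have hx := abs_le.mp (key φ x)
  have hy := abs_le.mp (key φ y)
  show eval φ.1 x - eval φ.1 y ≤ _
  linarith [hx.2, hy.1]

instance : Nonempty (Lip Γ) := ⟨⟨fun _ => 0, fun _ _ _ => by simp⟩⟩

/-- The path metric on the realization of a *tree*, all edges being isometric to `[0,1]`. It is
written as the supremum of `φ x - φ y` over the functions `φ` that are affine on every edge and
change by at most one along it. On a tree this is the length of the geodesic from `x` to `y`: such
functions are `1`-Lipschitz for the path metric, and the supremum is attained at the distance from
the end beyond `x` of the edge that contains `x`. -/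
noncomputable abbrev treeMetric (hΓ : Γ.Connected) : MetricSpace (Realization Γ) where
  dist x y := ⨆ φ : Lip Γ, (eval φ.1 x - eval φ.1 y)
  dist_self x := by simp
  dist_comm x y := by
    have key : ∀ a b : Realization Γ, (⨆ φ : Lip Γ, (eval φ.1 a - eval φ.1 b)) ≤
        ⨆ φ : Lip Γ, (eval φ.1 b - eval φ.1 a) := by
      intro a b
      refine ciSup_le fun φ => ?_
      let ψ : Lip Γ := ⟨fun v => - φ.1 v, fun u v h => by
        have := φ.2 v u h.symm
        rwa [show -φ.1 u - -φ.1 v = φ.1 v - φ.1 u by ring]⟩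
      have hψ : ∀ z : Realization Γ, eval ψ.1 z = - eval φ.1 z := by
        intro z
        simp [eval, ψ, Finsupp.sum]
      refine le_trans (le_of_eq ?_) (le_ciSup (bddAbove_range hΓ b a) ψ)
      rw [hψ, hψ]; ring
    exact le_antisymm (key x y) (key y x)
  dist_triangle x y z := by
    refine ciSup_le fun φ => ?_
    have h1 := le_ciSup (bddAbove_range hΓ x y) φ
    have h2 := le_ciSup (bddAbove_range hΓ y z) φ
    linarith
  eq_of_dist_eq_zero {x y} h := by
    classical
    have le : ∀ v, x.coord v ≤ y.coord v := by
      intro v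
      let φ : Lip Γ := ⟨Pi.single v 1, fun a b _ => by
        rw [Pi.single_apply, Pi.single_apply]
        split_ifs <;> simp⟩
      have h1 := le_ciSup (bddAbove_range hΓ x y) φ
      have h2 : eval φ.1 x - eval φ.1 y ≤ 0 := h1.trans h.le
      have h3 : eval φ.1 x = x.coord v := eval_single x v
      have h4 : eval φ.1 y = y.coord v := eval_single y v
      rw [h3, h4] at h2
      linarith
    have ge : ∀ v, y.coord v ≤ x.coord v := by
      intro v
      let φ : Lip Γ := ⟨fun w => - (Pi.single v 1 : V → ℝ) w, fun a b _ => by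
        beta_reduce
        rw [Pi.single_apply, Pi.single_apply]
        split_ifs <;> simp⟩
      have h1 := le_ciSup (bddAbove_range hΓ x y) φ
      have h2 : eval φ.1 x - eval φ.1 y ≤ 0 := h1.trans h.le
      have h3 : ∀ z : Realization Γ, eval φ.1 z = - z.coord v := by
        intro z
        rw [← eval_single z v]
        simp [eval, φ, Finsupp.sum]
      rw [h3, h3] at h2
      linarith
    exact ext_coord (Finsupp.ext fun v => le_antisymm (le v) (ge v))

/-- The action of a graph automorphism on the realization, affine on every edge. -/
noncomputable def map (f : Γ ≃g Γ) (x : Realization Γ) : Realization Γ where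
  coord := x.coord.equivMapDomain f.toEquiv
  nonneg v := by
    rw [Finsupp.equivMapDomain_apply]; exact x.nonneg _
  sum_eq_one := by
    rw [Finsupp.sum_equivMapDomain]; exact x.sum_eq_one
  supp := by
    obtain ⟨u, v, huv, h⟩ := x.supp
    refine ⟨f u, f v, huv.imp (congrArg f) (fun h => f.map_rel_iff.mpr h), fun w hw => ?_⟩
    rw [Finsupp.equivMapDomain_apply] at hw
    rcases h _ hw with h | h
    · exact Or.inl (f.toEquiv.symm_apply_eq.mp h)
    · exact Or.inr (f.toEquiv.symm_apply_eq.mp h)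

theorem eval_map (f : Γ ≃g Γ) (φ : V → ℝ) (x : Realization Γ) :
    eval φ (map f x) = eval (φ ∘ f) x := by
  unfold eval map
  rw [Finsupp.sum_equivMapDomain]; rfl

end Realization

end Realization

/-! ## The tree of a free group -/

section CayleyTree

variable {n : ℕ}

/-- The Cayley graph of the free group on `a_1, …, a_n` with respect to this basis; the neighbours
of `g` are the elements `g a_i` and `g a_i⁻¹`. -/
def freeCayleyGraph (n : ℕ) : SimpleGraph (FreeGroup (Fin n)) :=
  SimpleGraph.mulCayley (range FreeGroup.of)

theorem freeCayleyGraph_connected (n : ℕ) : (freeCayleyGraph n).Connected := by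
  have adj : ∀ (g : FreeGroup (Fin n)) (i : Fin n),
      (freeCayleyGraph n).Reachable g (g * FreeGroup.of i) := by
    intro g i
    refine SimpleGraph.Adj.reachable ?_
    rw [freeCayleyGraph, SimpleGraph.mulCayley_adj]
    refine ⟨fun h => FreeGroup.of_ne_one i (left_eq_mul.mp h), Or.inl ⟨i, by group⟩⟩
  have key : ∀ h g : FreeGroup (Fin n), (freeCayleyGraph n).Reachable g (g * h) := by
    intro h
    induction h using FreeGroup.induction_on with
    | C1 => intro g; rw [mul_one]
    | of i => intro g; exact adj g i
    | inv_of i _ =>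
      intro g
      have := adj (g * (FreeGroup.of i)⁻¹) i
      rw [inv_mul_cancel_right] at this
      exact this.symm
    | mul x y hx hy =>
      intro g
      rw [← mul_assoc]
      exact (hx g).trans (hy _)
  have : Nonempty (FreeGroup (Fin n)) := ⟨1⟩
  exact ⟨fun g h => by simpa using key (g⁻¹ * h) g⟩

/-- The Cayley tree `T` of the free group, as a metric space. -/
abbrev CayleyTree (n : ℕ) : Type := Realization (freeCayleyGraph n)

noncomputable instance (n : ℕ) : MetricSpace (CayleyTree n) :=
  Realization.treeMetric (freeCayleyGraph_connected n)

/-- Left translation by `g` as an automorphism of the Cayley graph. -/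
def leftTranslation (g : FreeGroup (Fin n)) : freeCayleyGraph n ≃g freeCayleyGraph n where
  toEquiv := Equiv.mulLeft g
  map_rel_iff' := by
    intro a b
    exact SimpleGraph.mulCayley_adj_mul_iff_right

theorem isometry_map_leftTranslation (g : FreeGroup (Fin n)) :
    Isometry (Realization.map (leftTranslation g) : CayleyTree n → CayleyTree n) := by
  refine Isometry.of_dist_eq fun x y => ?_
  show (⨆ φ : Realization.Lip (freeCayleyGraph n), _) =
    ⨆ φ : Realization.Lip (freeCayleyGraph n), _
  let e : Realization.Lip (freeCayleyGraph n) ≃ Realization.Lip (freeCayleyGraph n) :=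
    { toFun := fun φ => ⟨φ.1 ∘ leftTranslation g, fun u v h =>
        φ.2 _ _ ((leftTranslation g).map_rel_iff.mpr h)⟩
      invFun := fun φ => ⟨φ.1 ∘ (leftTranslation g).symm, fun u v h =>
        φ.2 _ _ ((leftTranslation g).symm.map_rel_iff.mpr h)⟩
      left_inv := fun φ => Subtype.ext (by funext v; simp)
      right_inv := fun φ => Subtype.ext (by funext v; simp) }
  refine Equiv.iSup_congr e fun φ => ?_
  rw [Realization.eval_map, Realization.eval_map]
  rfl

theorem map_leftTranslation_mul (g h : FreeGroup (Fin n)) (x : CayleyTree n) :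
    Realization.map (leftTranslation (g * h)) x =
      Realization.map (leftTranslation g) (Realization.map (leftTranslation h) x) := by
  refine Realization.ext_coord (Finsupp.ext fun v => ?_)
  simp only [Realization.map, Finsupp.equivMapDomain_apply]
  congr 1
  show (g * h)⁻¹ * v = h⁻¹ * (g⁻¹ * v)
  group

theorem map_leftTranslation_one (x : CayleyTree n) :
    Realization.map (leftTranslation 1) x = x := by
  refine Realization.ext_coord (Finsupp.ext fun v => ?_)
  simp only [Realization.map, Finsupp.equivMapDomain_apply]
  congr 1
  show (1 : FreeGroup (Fin n))⁻¹ * v = v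
  group

/-- The action of the free group on its Cayley tree by left translations. -/
noncomputable def cayleyAction (n : ℕ) : FreeGroup (Fin n) →* (CayleyTree n ≃ᵢ CayleyTree n) where
  toFun g :=
    { toFun := Realization.map (leftTranslation g)
      invFun := Realization.map (leftTranslation g⁻¹)
      left_inv := fun x => by
        rw [← map_leftTranslation_mul, inv_mul_cancel, map_leftTranslation_one]
      right_inv := fun x => by
        rw [← map_leftTranslation_mul, mul_inv_cancel, map_leftTranslation_one]
      isometry_toFun := isometry_map_leftTranslation g }
  map_one' := IsometryEquiv.ext fun x => map_leftTranslation_one x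
  map_mul' g h := IsometryEquiv.ext fun x => map_leftTranslation_mul g h x

/-- The boundary `∂T`: geodesic rays emanating from the vertex `1`. -/
abbrev CayleyBoundary (n : ℕ) : Type :=
  RayBoundary (CayleyTree n) (Realization.vertex (freeCayleyGraph n) 1)

/-- The infinite word `c_0 c_1 c_2 …` represents the end point `τ`: the ray passes at each time
`m ∈ ℕ` through the vertex `c_0 c_1 ⋯ c_{m-1}`. The letter `(i, true)` stands for `a_i` and
`(i, false)` for `a_i⁻¹`. (As `τ` is geodesic, the word is automatically reduced.) -/
def RepresentedBy (τ : CayleyBoundary n) (c : ℕ → Fin n × Bool) : Prop :=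
  ∀ m : ℕ, τ.1 (m : ℝ≥0) =
    Realization.vertex (freeCayleyGraph n) (FreeGroup.mk (List.ofFn fun j : Fin m => c j))

end CayleyTree

/-! ## The group `ℤ[1/(p_1 ⋯ p_n)] ⋊ F_n` -/

section Group

variable {n : ℕ}

/-- The ring `ℤ[1/(p_1 ⋯ p_n)]`, as a subring of `ℚ`. -/
abbrev ZInv (p : Fin n → Nat.Primes) : Subalgebra ℤ ℚ :=
  Algebra.adjoin ℤ {1 / ∏ i, ((p i : ℕ) : ℚ)}

theorem inv_mem_ZInv (p : Fin n → Nat.Primes) (i : Fin n) :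
    1 / ((p i : ℕ) : ℚ) ∈ ZInv p := by
  have h0 : ∀ j, ((p j : ℕ) : ℚ) ≠ 0 := fun j => Nat.cast_ne_zero.mpr (p j).2.ne_zero
  have h : 1 / ((p i : ℕ) : ℚ) =
      ((∏ j ∈ Finset.univ.erase i, (p j : ℕ) : ℕ) : ℚ) * (1 / ∏ i, ((p i : ℕ) : ℚ)) := by
    rw [← Finset.mul_prod_erase Finset.univ _ (Finset.mem_univ i)]
    have h1 : ∏ j ∈ Finset.univ.erase i, ((p j : ℕ) : ℚ) ≠ 0 :=
      Finset.prod_ne_zero_iff.mpr fun j _ => h0 j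
    have := h0 i
    push_cast
    field_simp
  rw [h]
  exact mul_mem (natCast_mem _ _) (Algebra.subset_adjoin rfl)

/-- The unit `1/p_i` of `ℤ[1/(p_1 ⋯ p_n)]`. -/
def invPrime (p : Fin n → Nat.Primes) (i : Fin n) : (ZInv p)ˣ where
  val := ⟨1 / ((p i : ℕ) : ℚ), inv_mem_ZInv p i⟩
  inv := ((p i : ℕ) : ZInv p)
  val_inv := Subtype.ext (by
    have : ((p i : ℕ) : ℚ) ≠ 0 := Nat.cast_ne_zero.mpr (p i).2.ne_zero
    simp [this])
  inv_val := Subtype.ext (by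
    have : ((p i : ℕ) : ℚ) ≠ 0 := Nat.cast_ne_zero.mpr (p i).2.ne_zero
    simp [this])

/-- The homomorphism `φ : A → Aut(B)` from the free group `A` on `a_1, …, a_n` to the automorphisms
of the additive group `B` of `ℤ[1/(p_1 ⋯ p_n)]`, under which `a_i` acts as multiplication by
`1/p_i`. -/
def primeAction (p : Fin n → Nat.Primes) :
    FreeGroup (Fin n) →* MulAut (Multiplicative (ZInv p)) :=
  FreeGroup.lift fun i =>
    (MulAutMultiplicative (G := ZInv p)).symm (AddAut.mulLeft (invPrime p i))

theorem primeAction_of (p : Fin n → Nat.Primes) (i : Fin n) (b : ZInv p) :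
    (((primeAction p (FreeGroup.of i) (Multiplicative.ofAdd b)).toAdd : ZInv p) : ℚ) =
      1 / ((p i : ℕ) : ℚ) * (b : ℚ) := by
  rw [primeAction, FreeGroup.lift_apply_of]
  rfl

/-- The semidirect product `G = B ⋊ A`. -/
abbrev PrimeGroup (p : Fin n → Nat.Primes) : Type :=
  Multiplicative (ZInv p) ⋊[primeAction p] FreeGroup (Fin n)

/-- The action `ρ` of `G = B ⋊ A` on the Cayley tree of `A`, through the projection `G → A`. -/
noncomputable def rhoAction (p : Fin n → Nat.Primes) :
    PrimeGroup p →* (CayleyTree n ≃ᵢ CayleyTree n) :=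
  (cayleyAction n).comp SemidirectProduct.rightHom

end Group

/-! ## Horoballs along nested balls -/

/-! Everything depends on how large the exponent sum of each `a_i` becomes on a horoball. Consider
the Cayley graph of `G` for the generators `1 ∈ B` and `a_1, …, a_n`, and its part over a connected
set `W` of vertices of the tree. Walking to `w ∈ W`, crossing a `B`-edge there and walking back
changes the `B`-coordinate by the factor `scale p w` through which `w` acts. The changes achievable
over `W` form a subgroup of `B`. Since the `p_i`-adic norm of `scale p w` is `p_i ^ exponent i w`,
this subgroup is all of `B` as soon as every exponent sum is unbounded above on `W`
(`eq_top_of_scaleElt_mem`, `eqvGen_liftedEdgeIn`).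

Horoballs are connected. If the word of `τ` is not eventually `a_i⁻¹`, then following `τ` for a long
time and turning off along powers of `a_i` makes the exponent sum arbitrarily large within any
horoball (`exists_le_exponent_horoball`). If this holds for every `i`, the Cayley graph is
controlled connected over `τ`, with lag zero.

If the word is eventually `a_i⁻¹`, the exponent sum falls along the ray as fast as a `1`-Lipschitz
function can rise from the ray to the boundary of the ball, so it is bounded above on every horoball
(`eval_exponent_le_of_mem_horoball`). For any `X` and `h`, the edges over a horoball then change the
`B`-coordinate by `p_i`-adically bounded amounts, and by the ultrametric inequality so do paths. But
`B` acts trivially on the tree, so the translates of one vertex by all `p_i⁻ᵏ` lie over the same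
horoball, and no lag suffices (`not_controlledConnected`). -/

theorem mem_horoball_of_dist_le {M : Type*} [MetricSpace M] {τ : ℝ≥0 → M} (hτ : Isometry τ) {t : ℝ}
    {x : M} {l l' : ℝ≥0} (hl : l ≤ l') (hx : dist x (τ l) ≤ (l : ℝ) - t) :
    dist x (τ l') ≤ (l' : ℝ) - t := by
  have h1 : dist (τ l) (τ l') = (l' : ℝ) - l := by
    rw [hτ.dist_eq, dist_comm, NNReal.dist_eq, abs_of_nonneg (sub_nonneg.mpr (by exact_mod_cast hl))]
  linarith [dist_triangle x (τ l) (τ l')]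

/-- The balls increase with `l`, so integer times suffice; at these the ray is at vertices. The
condition `t ≤ l` is automatic, a nonempty ball having nonnegative radius. -/
theorem mem_horoball_iff_nat {M : Type*} [MetricSpace M] {τ : ℝ≥0 → M} (hτ : Isometry τ) {t : ℝ}
    {x : M} : x ∈ horoball τ t ↔ ∃ m : ℕ, dist x (τ m) ≤ m - t := by
  simp only [horoball, mem_iUnion, Metric.mem_closedBall, exists_prop]
  constructor
  · rintro ⟨l, -, h⟩
    obtain ⟨m, hm⟩ := exists_nat_ge l
    exact ⟨m, by simpa using mem_horoball_of_dist_le hτ hm h⟩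
  · rintro ⟨m, h⟩
    exact ⟨m, by simpa using dist_nonneg.trans h, by simpa using h⟩

/-- Two points of a horoball lie in a common ball about a far vertex of the ray. -/
theorem exists_nat_of_mem_horoball {M : Type*} [MetricSpace M] {τ : ℝ≥0 → M} (hτ : Isometry τ)
    {t : ℝ} {x y : M} (hx : x ∈ horoball τ t) (hy : y ∈ horoball τ t) :
    ∃ m : ℕ, dist x (τ m) ≤ m - t ∧ dist y (τ m) ≤ m - t := by
  obtain ⟨k, hk⟩ := (mem_horoball_iff_nat hτ).mp hx
  obtain ⟨l, hl⟩ := (mem_horoball_iff_nat hτ).mp hy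
  refine ⟨max k l, ?_, ?_⟩
  · simpa using mem_horoball_of_dist_le (l := k) (l' := (max k l : ℕ)) hτ (by simp) (by simpa using hk)
  · simpa using mem_horoball_of_dist_le (l := l) (l' := (max k l : ℕ)) hτ (by simp) (by simpa using hl)

/-! ## Metric geometry of the Cayley tree -/

namespace Realization

section

variable {V : Type*} {Γ : SimpleGraph V}

@[simp]
theorem eval_vertex (φ : V → ℝ) (v : V) : eval φ (vertex Γ v) = φ v := by
  simp [eval, vertex]

theorem eval_sub_const (φ : V → ℝ) (c : ℝ) (x : Realization Γ) :
    eval (fun v => φ v - c) x = eval φ x - c := by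
  have : c = x.coord.sum fun _ s => s * c := by
    rw [← Finsupp.sum_mul, x.sum_eq_one, one_mul]
  conv_rhs => rw [this]
  unfold eval Finsupp.sum
  rw [← Finset.sum_sub_distrib]
  exact Finset.sum_congr rfl fun _ _ => by ring

theorem eval_mono {φ ψ : V → ℝ} (h : ∀ v, φ v ≤ ψ v) (x : Realization Γ) :
    eval φ x ≤ eval ψ x :=
  Finset.sum_le_sum fun v _ => mul_le_mul_of_nonneg_left (h v) (x.nonneg v)

/-- The point dividing the (possibly degenerate) edge from `u` to `v` in the ratio `s : 1 - s`. -/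
noncomputable def edgePoint {u v : V} (h : u = v ∨ Γ.Adj u v) (s : I) : Realization Γ where
  coord := Finsupp.single u (1 - (s : ℝ)) + Finsupp.single v (s : ℝ)
  nonneg w := by
    classical
    have h0 := s.2.1
    have h1 := s.2.2
    rw [Finsupp.add_apply, Finsupp.single_apply, Finsupp.single_apply]
    split_ifs <;> linarith
  sum_eq_one := by
    rw [Finsupp.sum_add_index' (fun _ => rfl) (fun _ _ _ => rfl),
      Finsupp.sum_single_index rfl, Finsupp.sum_single_index rfl]
    ring
  supp := ⟨u, v, h, fun w hw => by
    classical
    by_contra! hc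
    exact hw (by simp [hc.1.symm, hc.2.symm])⟩

theorem eval_edgePoint (φ : V → ℝ) {u v : V} (h : u = v ∨ Γ.Adj u v) (s : I) :
    eval φ (edgePoint h s) = (1 - (s : ℝ)) * φ u + s * φ v := by
  rw [eval, edgePoint, Finsupp.sum_add_index' (by simp) (by intros; ring),
    Finsupp.sum_single_index (by simp), Finsupp.sum_single_index (by simp)]

/-- A point of the realization is a point of an edge. -/
theorem exists_eq_edgePoint (x : Realization Γ) : ∃ (u v : V) (h : u = v ∨ Γ.Adj u v) (s : I),
    x = edgePoint h s := by
  classical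
  obtain ⟨u, v, huv, h⟩ := x.supp
  have hsub : x.coord.support ⊆ {u, v} := fun w hw => by
    simpa using h w (Finsupp.mem_support_iff.mp hw)
  have hsum := x.sum_eq_one
  rw [Finsupp.sum_of_support_subset _ hsub _ (fun _ _ => rfl)] at hsum
  by_cases e : u = v
  · subst e
    refine ⟨u, u, Or.inl rfl, 0, ext_coord (Finsupp.ext fun w => ?_)⟩
    have hu : x.coord u = 1 := by simpa using hsum
    by_cases hw : w = u
    · subst hw; simp [edgePoint, hu]
    · have : x.coord w = 0 := by by_contra hc; exact hw (by simpa using h w hc)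
      simp [edgePoint, this, Ne.symm hw]
  · rw [Finset.sum_pair e] at hsum
    refine ⟨u, v, huv, ⟨x.coord v, x.nonneg v, by linarith [x.nonneg u]⟩,
      ext_coord (Finsupp.ext fun w => ?_)⟩
    by_cases hw : w = u
    · subst hw; simp [edgePoint, Ne.symm e]; linarith
    · by_cases hw' : w = v
      · subst hw'; simp [edgePoint, e]
      · have : x.coord w = 0 := by
          by_contra hc; exact (h w hc).elim hw hw'
        simp [edgePoint, this, Ne.symm hw, Ne.symm hw']

theorem edgePoint_zero {u v : V} (h : u = v ∨ Γ.Adj u v) : edgePoint h 0 = vertex Γ u :=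
  ext_coord (by simp [edgePoint, vertex])

theorem edgePoint_one {u v : V} (h : u = v ∨ Γ.Adj u v) : edgePoint h 1 = vertex Γ v :=
  ext_coord (by simp [edgePoint, vertex])

end

section CayleyTree

variable {n : ℕ}

theorem eval_sub_eval_le_dist (φ : FreeGroup (Fin n) → ℝ)
    (hφ : ∀ u v, (freeCayleyGraph n).Adj u v → |φ u - φ v| ≤ 1) (x y : CayleyTree n) :
    eval φ x - eval φ y ≤ dist x y :=
  le_ciSup (bddAbove_range (freeCayleyGraph_connected n) x y) ⟨φ, hφ⟩

theorem dist_le_iff (x y : CayleyTree n) (r : ℝ) :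
    dist x y ≤ r ↔ ∀ φ : Lip (freeCayleyGraph n), eval φ.1 x - eval φ.1 y ≤ r :=
  ciSup_le_iff (bddAbove_range (freeCayleyGraph_connected n) x y)

theorem abs_dist_sub_dist_le (w u v : FreeGroup (Fin n)) (h : (freeCayleyGraph n).Adj u v) :
    |((freeCayleyGraph n).dist u w : ℝ) - (freeCayleyGraph n).dist v w| ≤ 1 := by
  have hc := freeCayleyGraph_connected n
  have h1 := SimpleGraph.dist_eq_one_iff_adj.mpr h
  have h2 := hc.dist_triangle (u := u) (v := v) (w := w)
  have h3 := hc.dist_triangle (u := v) (v := u) (w := w)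
  rw [SimpleGraph.dist_comm (u := v) (v := u)] at h3
  rw [h1] at h2 h3
  rw [abs_le]
  constructor <;> [have := h3; have := h2] <;> rify at this <;> linarith

/-- The supremum defining the metric is attained at the graph distance to `w`, which dominates every
other admissible function normalized to vanish at `w`. -/
theorem dist_vertex_right (x : CayleyTree n) (w : FreeGroup (Fin n)) :
    dist x (vertex _ w) = eval (fun v => ((freeCayleyGraph n).dist v w : ℝ)) x := by
  apply le_antisymm
  · rw [dist_le_iff]
    intro φ
    rw [eval_vertex, ← eval_sub_const]
    exact eval_mono (fun v => (le_abs_self _).trans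
      (lip_dist (freeCayleyGraph_connected n) φ v w)) x
  · simpa using eval_sub_eval_le_dist _ (abs_dist_sub_dist_le w) x (vertex _ w)

theorem dist_vertex (v w : FreeGroup (Fin n)) :
    dist (vertex (freeCayleyGraph n) v : CayleyTree n) (vertex _ w) =
      (freeCayleyGraph n).dist v w := by
  rw [dist_vertex_right, eval_vertex]

/-- Balls are convex along edges. -/
theorem dist_edgePoint_le {u v : FreeGroup (Fin n)} (h : u = v ∨ (freeCayleyGraph n).Adj u v)
    (s : I) (y : CayleyTree n) {r : ℝ} (hu : dist (vertex _ u : CayleyTree n) y ≤ r)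
    (hv : dist (vertex _ v : CayleyTree n) y ≤ r) :
    dist (edgePoint h s : CayleyTree n) y ≤ r := by
  rw [dist_le_iff] at *
  intro φ
  have h1 := hu φ
  have h2 := hv φ
  rw [eval_vertex] at h1 h2
  rw [eval_edgePoint]
  nlinarith [s.2.1, s.2.2, mul_le_mul_of_nonneg_left h1 (sub_nonneg.mpr s.2.2),
    mul_le_mul_of_nonneg_left h2 s.2.1]

theorem dist_edgePoint_edgePoint_le {u v : FreeGroup (Fin n)}
    (h : u = v ∨ (freeCayleyGraph n).Adj u v) (s s' : I) :
    dist (edgePoint h s : CayleyTree n) (edgePoint h s') ≤ dist s s' := by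
  rw [dist_le_iff]
  intro φ
  rw [eval_edgePoint, eval_edgePoint, Subtype.dist_eq, Real.dist_eq]
  have h1 : |φ.1 v - φ.1 u| ≤ 1 := by
    rcases h with rfl | h
    · simp
    · exact φ.2 _ _ h.symm
  calc _ = ((s : ℝ) - s') * (φ.1 v - φ.1 u) := by ring
    _ ≤ |((s : ℝ) - s') * (φ.1 v - φ.1 u)| := le_abs_self _
    _ ≤ |(s : ℝ) - s'| * 1 := by
      rw [abs_mul]; exact mul_le_mul_of_nonneg_left h1 (abs_nonneg _)
    _ = _ := mul_one _

/-- The affine path along an edge. -/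
noncomputable def edgePath {u v : FreeGroup (Fin n)} (h : u = v ∨ (freeCayleyGraph n).Adj u v) :
    Path (vertex _ u : CayleyTree n) (vertex _ v) where
  toFun := edgePoint h
  continuous_toFun := (LipschitzWith.of_dist_le_mul (K := 1) fun s s' => by
    simpa using dist_edgePoint_edgePoint_le h s s').continuous
  source' := edgePoint_zero h
  target' := edgePoint_one h

theorem map_leftTranslation_vertex (g u : FreeGroup (Fin n)) :
    map (leftTranslation g) (vertex (freeCayleyGraph n) u) = vertex _ (g * u) :=
  ext_coord (Finsupp.equivMapDomain_single _ _ _)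

theorem map_leftTranslation_edgePoint {g u v u' v' : FreeGroup (Fin n)} (hu : g * u = u')
    (hv : g * v = v') (h : u = v ∨ (freeCayleyGraph n).Adj u v)
    (h' : u' = v' ∨ (freeCayleyGraph n).Adj u' v') (s : I) :
    map (leftTranslation g) (edgePoint h s) = edgePoint h' s :=
  ext_coord (Finsupp.ext fun w => by
    classical
    subst hu hv
    simp only [map, edgePoint, Finsupp.equivMapDomain_apply, Finsupp.add_apply,
      Finsupp.single_apply]
    have : ∀ a, (a = (leftTranslation g).toEquiv.symm w) = (g * a = w) := fun a =>
      propext (Equiv.eq_symm_apply _)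
    simp only [this])

end CayleyTree

end Realization

/-! ## Adjacency, parity and exponent sums in the free group -/

section FreeGroup

variable {n : ℕ}

theorem freeCayleyGraph_adj_mul_of (u : FreeGroup (Fin n)) (i : Fin n) :
    (freeCayleyGraph n).Adj u (u * FreeGroup.of i) := by
  rw [freeCayleyGraph, SimpleGraph.mulCayley_adj]
  exact ⟨fun h => FreeGroup.of_ne_one i (left_eq_mul.mp h), Or.inl ⟨i, by group⟩⟩

theorem exists_of_freeCayleyGraph_adj {u v : FreeGroup (Fin n)} (h : (freeCayleyGraph n).Adj u v) :
    ∃ i, v = u * FreeGroup.of i ∨ u = v * FreeGroup.of i := by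
  rw [freeCayleyGraph, SimpleGraph.mulCayley_adj] at h
  rcases h with ⟨-, ⟨i, hi⟩ | ⟨i, hi⟩⟩
  · exact ⟨i, Or.inl (by rw [hi]; group)⟩
  · exact ⟨i, Or.inr (by rw [hi]; group)⟩

/-- The Cayley graph is bipartite: the homomorphism to `ZMod 2` sending every generator to `1`
computes the parity of the distance to `1`. -/
theorem dist_one_ne_of_adj {u v : FreeGroup (Fin n)} (h : (freeCayleyGraph n).Adj u v) :
    (freeCayleyGraph n).dist u 1 ≠ (freeCayleyGraph n).dist v 1 := by
  let par : FreeGroup (Fin n) →* Multiplicative (ZMod 2) :=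
    FreeGroup.lift fun _ => Multiplicative.ofAdd 1
  have step : ∀ u v : FreeGroup (Fin n), (freeCayleyGraph n).Adj u v →
      (par u).toAdd = (par v).toAdd + 1 := by
    intro u v h
    have two : (1 : ZMod 2) + 1 = 0 := rfl
    obtain ⟨i, rfl | rfl⟩ := exists_of_freeCayleyGraph_adj h
    · simp [par, add_assoc, two]
    · simp [par]
  have walk : ∀ u : FreeGroup (Fin n),
      (par u).toAdd = ((freeCayleyGraph n).dist u 1 : ZMod 2) := by
    intro u
    obtain ⟨w, hw⟩ := (freeCayleyGraph_connected n).exists_walk_length_eq_dist u 1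
    rw [← hw]
    clear hw
    have : ∀ (u v : FreeGroup (Fin n)) (w : (freeCayleyGraph n).Walk u v),
        (par u).toAdd = (par v).toAdd + (w.length : ZMod 2) := by
      intro u v w
      induction w with
      | nil => simp
      | cons h p ih => rw [step _ _ h, ih, SimpleGraph.Walk.length_cons]; push_cast; ring
    simpa using this u 1 w
  intro e
  have := step u v h
  rw [walk, walk, e] at this
  simp at this

/-- The exponent sum of `a_i`. -/
def expSum (i : Fin n) : FreeGroup (Fin n) →* Multiplicative ℤ :=
  FreeGroup.lift fun j => Multiplicative.ofAdd (if j = i then 1 else 0)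

/-- The exponent sum of `a_i` as an integer. -/
def exponent (i : Fin n) (w : FreeGroup (Fin n)) : ℤ := (expSum i w).toAdd

@[simp]
theorem exponent_one (i : Fin n) : exponent i 1 = 0 := by simp [exponent]

@[simp]
theorem exponent_mul (i : Fin n) (v w : FreeGroup (Fin n)) :
    exponent i (v * w) = exponent i v + exponent i w := by simp [exponent]

@[simp]
theorem exponent_inv (i : Fin n) (w : FreeGroup (Fin n)) :
    exponent i w⁻¹ = - exponent i w := by simp [exponent]

@[simp]
theorem exponent_of (i j : Fin n) :
    exponent i (FreeGroup.of j) = if j = i then 1 else 0 := by simp [exponent, expSum]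

@[simp]
theorem exponent_pow (i : Fin n) (w : FreeGroup (Fin n)) (k : ℕ) :
    exponent i (w ^ k) = k * exponent i w := by simp [exponent]

theorem mk_letter (x : Fin n × Bool) :
    FreeGroup.mk [x] = if x.2 then FreeGroup.of x.1 else (FreeGroup.of x.1)⁻¹ := by
  obtain ⟨j, b⟩ := x
  cases b <;> rfl

theorem exponent_lipschitz (i : Fin n) (u v : FreeGroup (Fin n))
    (h : (freeCayleyGraph n).Adj u v) : |(exponent i u : ℝ) - exponent i v| ≤ 1 := by
  obtain ⟨j, rfl | rfl⟩ := exists_of_freeCayleyGraph_adj h <;>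
  · rw [exponent_mul, exponent_of]
    split_ifs <;> simp

theorem mk_ofFn_succ (c : ℕ → Fin n × Bool) (m : ℕ) :
    FreeGroup.mk (List.ofFn fun j : Fin (m + 1) => c j) =
      FreeGroup.mk (List.ofFn fun j : Fin m => c j) * FreeGroup.mk [c m] := by
  rw [FreeGroup.mul_mk, List.ofFn_succ', List.concat_eq_append]
  rfl

/-! ## Rays and infinite words -/

open Realization in
-- The distances to `1` from the two ends of an edge differ by exactly one, so a point of the edge
-- at integer distance from `1` has an integral affine coordinate and is an end.
theorem exists_vertex_of_ray (τ : CayleyBoundary n) (m : ℕ) :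
    ∃ g, τ.1 m = vertex (freeCayleyGraph n) g := by
  have hd : dist (τ.1 m) (vertex (freeCayleyGraph n) 1) = m := by
    have h := τ.2.1.dist_eq m 0
    rw [τ.2.2, NNReal.dist_eq] at h
    simpa using h
  obtain ⟨u, v, h, s, hs⟩ := exists_eq_edgePoint (τ.1 m)
  rw [hs] at hd ⊢
  rw [dist_vertex_right, eval_edgePoint] at hd
  by_cases e : u = v
  · subst e
    refine ⟨u, ext_coord ?_⟩
    exact (Finsupp.single_add _ _ _).symm.trans (by rw [sub_add_cancel]; rfl)
  have hadj := h.resolve_left e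
  have h1 := abs_dist_sub_dist_le 1 u v hadj
  have h2 := dist_one_ne_of_adj hadj
  generalize (freeCayleyGraph n).dist u 1 = a at *
  generalize (freeCayleyGraph n).dist v 1 = b at *
  have hs0 := s.2.1
  have hs1 := s.2.2
  have hab : (b : ℝ) = a + 1 ∨ (b : ℝ) = a - 1 := by
    rw [abs_le] at h1
    have h3 : (a : ℤ) - b ≤ 1 := by exact_mod_cast h1.2
    have h4 : (-1 : ℤ) ≤ a - b := by exact_mod_cast h1.1
    have : (b : ℤ) = a + 1 ∨ (b : ℤ) = a - 1 := by omega
    rcases this with h | h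
    · left; exact_mod_cast h
    · right; exact_mod_cast h
  have hz : ∃ z : ℤ, (s : ℝ) = z := by
    rcases hab with h | h
    · exact ⟨m - a, by rw [h] at hd; push_cast; linarith⟩
    · exact ⟨a - m, by rw [h] at hd; push_cast; linarith⟩
  obtain ⟨z, hz⟩ := hz
  rw [hz] at hs0 hs1
  have h5 : (0 : ℤ) ≤ z := by exact_mod_cast hs0
  have h6 : z ≤ 1 := by exact_mod_cast hs1
  rcases (show z = 0 ∨ z = 1 by omega) with rfl | rfl
  · refine ⟨u, ?_⟩
    rw [show s = 0 from Subtype.ext (by simpa using hz), edgePoint_zero]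
  · refine ⟨v, ?_⟩
    rw [show s = 1 from Subtype.ext (by simpa using hz), edgePoint_one]

open Realization in
theorem vertex_injective : Function.Injective (vertex (freeCayleyGraph n)) := by
  intro u v h
  have := dist_vertex u v
  rw [h, dist_self] at this
  exact ((freeCayleyGraph_connected n).dist_eq_zero_iff).mp (by exact_mod_cast this.symm)

open Realization in
/-- Every end point is represented by an infinite word. -/
theorem exists_representedBy (τ : CayleyBoundary n) : ∃ c, RepresentedBy τ c := by
  choose g hg using exists_vertex_of_ray τ
  have hadj : ∀ m, (freeCayleyGraph n).Adj (g m) (g (m + 1)) := by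
    intro m
    rw [← SimpleGraph.dist_eq_one_iff_adj]
    have h : dist (τ.1 (m : ℕ)) (τ.1 (m + 1 : ℕ)) = 1 := by
      rw [τ.2.1.dist_eq, NNReal.dist_eq]; simp
    rw [hg, hg, dist_vertex] at h
    exact_mod_cast h
  have hletter : ∀ m, ∃ x : Fin n × Bool, g (m + 1) = g m * FreeGroup.mk [x] := by
    intro m
    obtain ⟨i, h | h⟩ := exists_of_freeCayleyGraph_adj (hadj m)
    · exact ⟨(i, true), h⟩
    · exact ⟨(i, false), by rw [mk_letter, h]; simp⟩
  choose c hc using hletter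
  refine ⟨c, fun m => ?_⟩
  rw [hg]
  congr 1
  induction m with
  | zero =>
    apply vertex_injective
    have := hg 0
    rw [Nat.cast_zero, τ.2.2] at this
    rw [← this]; rfl
  | succ m ih => rw [hc, ih, mk_ofFn_succ]

theorem exponent_mk_letter_nonneg (i : Fin n) (x : Fin n × Bool) :
    0 ≤ 1 + exponent i (FreeGroup.mk [x]) := by
  rw [mk_letter]; split_ifs <;> simp <;> split_ifs <;> simp

theorem exponent_mk_letter_pos {i : Fin n} {x : Fin n × Bool} (hx : x ≠ (i, false)) :
    1 ≤ 1 + exponent i (FreeGroup.mk [x]) := by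
  rw [mk_letter]
  split_ifs with hb
  · simp; split_ifs <;> simp
  · have : x.1 ≠ i := fun h => hx (Prod.ext h (by simpa using hb))
    simp [this]

/-- If the word is not eventually constant equal to `a_i⁻¹`, then the exponent sum of `a_i` in its
prefixes exceeds the negative of their lengths by arbitrarily large amounts. -/
theorem exists_le_exponent_prefix {c : ℕ → Fin n × Bool} {i : Fin n}
    (hc : ∀ N, ∃ m ≥ N, c m ≠ (i, false)) (K : ℕ) :
    ∃ l : ℕ, ∀ m ≥ l,
      (K : ℤ) ≤ m + exponent i (FreeGroup.mk (List.ofFn fun j : Fin m => c j)) := by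
  -- A letter raises `f` by `0` if it is `a_i⁻¹`, by `2` if it is `a_i`, and by `1` otherwise.
  set f : ℕ → ℤ := fun m => m + exponent i (FreeGroup.mk (List.ofFn fun j : Fin m => c j)) with hf
  have hsucc : ∀ m, f (m + 1) = f m + (1 + exponent i (FreeGroup.mk [c m])) := by
    intro m
    simp only [hf]
    rw [mk_ofFn_succ, exponent_mul]; push_cast; ring
  have hmono : Monotone f := monotone_nat_of_le_succ fun m => by
    rw [hsucc]; linarith [exponent_mk_letter_nonneg i (c m)]
  suffices ∃ l, (K : ℤ) ≤ f l from this.imp fun l hl m hm => hl.trans (hmono hm)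
  induction K with
  | zero => exact ⟨0, by simp only [hf]; simp [← FreeGroup.one_eq_mk]⟩
  | succ K ih =>
    obtain ⟨l, hl⟩ := ih
    obtain ⟨m, hm, hcm⟩ := hc l
    refine ⟨m + 1, ?_⟩
    rw [hsucc]
    push_cast
    linarith [hmono hm, exponent_mk_letter_pos hcm]

theorem exponent_prefix_of_eventually {c : ℕ → Fin n × Bool} {i : Fin n} {N : ℕ}
    (hc : ∀ m ≥ N, c m = (i, false)) :
    ∃ C : ℤ, ∀ m ≥ N, exponent i (FreeGroup.mk (List.ofFn fun j : Fin m => c j)) = C - m := by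
  refine ⟨exponent i (FreeGroup.mk (List.ofFn fun j : Fin N => c j)) + N, fun m hm => ?_⟩
  induction m, hm using Nat.le_induction with
  | base => ring
  | succ m hm ih =>
    rw [mk_ofFn_succ, exponent_mul, ih, hc m hm, mk_letter]
    simp; ring

end FreeGroup

/-! ## The factor by which the free group scales `ℤ[1/(p_1 ⋯ p_n)]` -/

section Scale

variable {n : ℕ} (p : Fin n → Nat.Primes)

/-- The rational number by which `w` acts on `ℤ[1/(p_1 ⋯ p_n)]`. -/
def scale (w : FreeGroup (Fin n)) : ℚ := ∏ j, ((p j : ℕ) : ℚ) ^ (-exponent j w)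

theorem scale_ne_zero (w : FreeGroup (Fin n)) : scale p w ≠ 0 :=
  Finset.prod_ne_zero_iff.mpr fun j _ =>
    zpow_ne_zero _ (Nat.cast_ne_zero.mpr (p j).2.ne_zero)

@[simp]
theorem scale_one : scale p 1 = 1 := by simp [scale]

@[simp]
theorem scale_mul (v w : FreeGroup (Fin n)) : scale p (v * w) = scale p v * scale p w := by
  rw [scale, scale, scale, ← Finset.prod_mul_distrib]
  refine Finset.prod_congr rfl fun j _ => ?_
  rw [← zpow_add₀ (Nat.cast_ne_zero.mpr (p j).2.ne_zero), exponent_mul]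
  congr 1; ring

@[simp]
theorem scale_inv (w : FreeGroup (Fin n)) : scale p w⁻¹ = (scale p w)⁻¹ :=
  eq_inv_of_mul_eq_one_left (by rw [← scale_mul, inv_mul_cancel, scale_one])

@[simp]
theorem scale_of (i : Fin n) : scale p (FreeGroup.of i) = 1 / ((p i : ℕ) : ℚ) := by
  rw [scale, Finset.prod_eq_single i]
  · simp
  · intro j _ hj; simp [hj.symm]
  · simp

theorem coe_primeAction (w : FreeGroup (Fin n)) (b : Multiplicative (ZInv p)) :
    ((primeAction p w b).toAdd : ℚ) = scale p w * (b.toAdd : ℚ) := by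
  induction w using FreeGroup.induction_on generalizing b with
  | C1 => simp
  | of i => rw [scale_of]; exact primeAction_of p i b.toAdd
  | inv_of i ih =>
    have := ih (primeAction p (FreeGroup.of i)⁻¹ b)
    rw [← MulAut.mul_apply, ← map_mul, mul_inv_cancel, map_one, MulAut.one_apply] at this
    rw [this, scale_inv, inv_mul_cancel_left₀ (scale_ne_zero p _)]
  | mul v w hv hw => rw [map_mul, MulAut.mul_apply, hv, hw, scale_mul, mul_assoc]

variable {p}

/-- Injectivity of `p` makes the other primes units at `p i`, so only the exponent sum of `a_i` is
seen. -/
theorem padicNorm_scale (hp : Function.Injective p) (i : Fin n) (w : FreeGroup (Fin n)) :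
    padicNorm (p i) (scale p w) = ((p i : ℕ) : ℚ) ^ exponent i w := by
  have : Fact (p i : ℕ).Prime := ⟨(p i).2⟩
  have h0 : ((p i : ℕ) : ℚ) ≠ 0 := Nat.cast_ne_zero.mpr (p i).2.ne_zero
  have hof : ∀ j, padicNorm (p i) (scale p (FreeGroup.of j)) =
      ((p i : ℕ) : ℚ) ^ exponent i (FreeGroup.of j) := by
    intro j
    rw [scale_of, padicNorm.div, padicNorm.one, exponent_of]
    split_ifs with h
    · subst h; simp [padicNorm.padicNorm_p_of_prime]
    · have : Fact (p j : ℕ).Prime := ⟨(p j).2⟩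
      rw [padicNorm.padicNorm_of_prime_of_ne fun e => h (hp (Subtype.ext e)).symm]
      simp
  induction w using FreeGroup.induction_on with
  | C1 => simp
  | of j => exact hof j
  | inv_of j ih =>
    rw [scale_inv, inv_eq_one_div, padicNorm.div, padicNorm.one, ih, exponent_inv, zpow_neg,
      one_div]
  | mul v w hv hw => rw [scale_mul, padicNorm.mul, hv, hw, exponent_mul, zpow_add₀ h0]

theorem padicNorm_scale_of_ne {q : ℕ} [Fact q.Prime] (hq : ∀ i, q ≠ p i)
    (w : FreeGroup (Fin n)) : padicNorm q (scale p w) = 1 := by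
  induction w using FreeGroup.induction_on with
  | C1 => simp
  | of j =>
    have : Fact (p j : ℕ).Prime := ⟨(p j).2⟩
    rw [scale_of, padicNorm.div, padicNorm.one, padicNorm.padicNorm_of_prime_of_ne (hq j), div_one]
  | inv_of j ih => rw [scale_inv, inv_eq_one_div, padicNorm.div, padicNorm.one, ih, div_one]
  | mul v w hv hw => rw [scale_mul, padicNorm.mul, hv, hw, one_mul]

theorem padicNorm_le_one_of_mem_ZInv {q : ℕ} [Fact q.Prime] (hq : ∀ i, q ≠ p i) (b : ZInv p) :
    padicNorm q b ≤ 1 := by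
  obtain ⟨b, hb⟩ := b
  induction hb using Algebra.adjoin_induction with
  | mem x hx =>
    rw [mem_singleton_iff] at hx
    subst hx
    have key : ∀ s : Finset (Fin n), padicNorm q (∏ i ∈ s, ((p i : ℕ) : ℚ)) = 1 := by
      intro s
      induction s using Finset.cons_induction with
      | empty => simp
      | cons i s hi ih =>
        have : Fact (p i : ℕ).Prime := ⟨(p i).2⟩
        rw [Finset.prod_cons, padicNorm.mul, ih, padicNorm.padicNorm_of_prime_of_ne (hq i), one_mul]
    show padicNorm q (1 / ∏ i, ((p i : ℕ) : ℚ)) ≤ 1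
    rw [padicNorm.div, padicNorm.one, key, div_one]
  | algebraMap r => exact padicNorm.of_int r
  | add x y _ _ hx hy => exact padicNorm.nonarchimedean.trans (max_le hx hy)
  | mul x y _ _ hx hy =>
    show padicNorm q (x * y) ≤ 1
    rw [padicNorm.mul]
    exact mul_le_one₀ hx (padicNorm.nonneg _) hy

theorem not_dvd_den_of_padicNorm_le_one {q : ℕ} [hq : Fact q.Prime] {r : ℚ}
    (hr : padicNorm q r ≤ 1) : ¬ q ∣ r.den := by
  intro h
  have hnum : ¬ (q : ℤ) ∣ r.num := fun h' =>
    hq.out.one_lt.ne' (Nat.dvd_one.mp (r.reduced ▸ Nat.dvd_gcd (Int.natCast_dvd.mp h') h))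
  have h1 := (padicNorm.nat_lt_one_iff (p := q) r.den).mpr h
  have h2 := (padicNorm.int_eq_one_iff (p := q) r.num).mpr hnum
  have h3 : padicNorm q r * padicNorm q r.den = 1 := by
    rw [← padicNorm.mul, Rat.mul_den_eq_num, h2]
  nlinarith [padicNorm.nonneg (p := q) (r.den : ℚ), padicNorm.nonneg (p := q) r]

/-- The scaling factor of `w` as an element of `ℤ[1/(p_1 ⋯ p_n)]`. -/
def scaleElt (p : Fin n → Nat.Primes) (w : FreeGroup (Fin n)) : ZInv p :=
  (primeAction p w (Multiplicative.ofAdd 1)).toAdd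

theorem coe_scaleElt (w : FreeGroup (Fin n)) : (scaleElt p w : ℚ) = scale p w := by
  rw [scaleElt, coe_primeAction]; simp

/-- A subgroup of `ℤ[1/(p_1 ⋯ p_n)]` that contains products of powers of the `p_i` with
arbitrarily negative exponents at every `p_i` is the whole group. -/
theorem eq_top_of_scaleElt_mem (hp : Function.Injective p) (S : AddSubgroup (ZInv p))
    {W : Set (FreeGroup (Fin n))} (hne : W.Nonempty) (hS : ∀ w ∈ W, scaleElt p w ∈ S)
    (hexp : ∀ (i : Fin n) (K : ℕ), ∃ w ∈ W, (K : ℤ) ≤ exponent i w) : S = ⊤ := by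
  rw [eq_top_iff]
  rintro b -
  -- The integers `m` with `m • b ∈ S` form an ideal of `ℤ`; it is the unit ideal if no prime `q`
  -- divides all its members.
  have key : ∀ q : ℕ, q.Prime → ∃ m : ℤ, ¬ (q : ℤ) ∣ m ∧ m • b ∈ S := by
    intro q hq
    have : Fact q.Prime := ⟨hq⟩
    have hw : ∃ w ∈ W, padicNorm q b ≤ padicNorm q (scale p w) := by
      by_cases h : ∃ i, q = p i
      · obtain ⟨i, rfl⟩ := h
        have h1 : (1 : ℚ) < (p i : ℕ) := by exact_mod_cast (p i).2.one_lt
        obtain ⟨K, hK⟩ := pow_unbounded_of_one_lt (padicNorm (p i) b) h1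
        obtain ⟨w, hw, hKw⟩ := hexp i K
        refine ⟨w, hw, hK.le.trans ?_⟩
        rw [padicNorm_scale hp, ← zpow_natCast]
        exact zpow_le_zpow_right₀ h1.le hKw
      · push Not at h
        obtain ⟨w, hw⟩ := hne
        exact ⟨w, hw, by
          rw [padicNorm_scale_of_ne h]; exact padicNorm_le_one_of_mem_ZInv h b⟩
    obtain ⟨w, hw, hle⟩ := hw
    have h0 := scale_ne_zero p w
    -- By the choice of `w` this quotient is `q`-integral, so its denominator is the required
    -- multiplier.
    set r : ℚ := b / scale p w with hr
    have hr1 : padicNorm q r ≤ 1 := by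
      rw [hr, padicNorm.div]
      exact div_le_one_of_le₀ hle (padicNorm.nonneg _)
    refine ⟨r.den, fun h => not_dvd_den_of_padicNorm_le_one hr1 (by exact_mod_cast h), ?_⟩
    have : (r.den : ℤ) • b = r.num • scaleElt p w := by
      apply Subtype.ext
      push_cast
      rw [zsmul_eq_mul, coe_scaleElt, zsmul_eq_mul, ← Rat.mul_den_eq_num r]
      push_cast
      rw [hr]; field_simp
    rw [this]
    exact S.zsmul_mem (hS w hw) _
  obtain ⟨d, hd⟩ := Int.subgroup_cyclic (S.comap (zmultiplesHom _ b))
  have hmem : ∀ m : ℤ, m • b ∈ S ↔ d ∣ m := by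
    intro m
    rw [← Int.mem_zmultiples_iff, AddSubgroup.zmultiples_eq_closure, ← hd]
    rfl
  have hd1 : d.natAbs = 1 := by
    by_contra h
    obtain ⟨q, hq, hqd⟩ := Nat.exists_prime_and_dvd h
    obtain ⟨m, hm, hmS⟩ := key q hq
    exact hm ((Int.natCast_dvd.mpr hqd).trans ((hmem m).mp hmS))
  simpa using (hmem 1).mpr (Int.isUnit_iff_natAbs_eq.mpr hd1).dvd

end Scale

/-! ## Paths in the Cayley graph of `B ⋊ A` over a subset of `A` -/

section Paths

variable {n : ℕ} {p : Fin n → Nat.Primes}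

/-- Edges of the Cayley graph of the free group with both ends in `W`. -/
def EdgeIn (W : Set (FreeGroup (Fin n))) (u v : FreeGroup (Fin n)) : Prop :=
  u ∈ W ∧ v ∈ W ∧ ∃ i, v = u * FreeGroup.of i

theorem eqvGen_edgeIn_of_walk {W : Set (FreeGroup (Fin n))} {u v : FreeGroup (Fin n)}
    (q : (freeCayleyGraph n).Walk u v) (hq : ∀ x ∈ q.support, x ∈ W) :
    Relation.EqvGen (EdgeIn W) u v := by
  induction q with
  | nil => exact .refl _
  | @cons u x v h q ih =>
    rw [SimpleGraph.Walk.support_cons] at hq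
    have hx : x ∈ W := hq x (List.mem_cons_of_mem _ q.start_mem_support)
    have hu : u ∈ W := hq u List.mem_cons_self
    refine .trans _ x _ ?_ (ih fun y hy => hq y (List.mem_cons_of_mem _ hy))
    obtain ⟨i, h | h⟩ := exists_of_freeCayleyGraph_adj h
    · exact .rel _ _ ⟨hu, hx, i, h⟩
    · exact .symm _ _ (.rel _ _ ⟨hx, hu, i, h⟩)

/-- The generators `1 ∈ B` and `a_1, …, a_n` of `B ⋊ A`. -/
def gen (p : Fin n → Nat.Primes) : Option (Fin n) → PrimeGroup p
  | none => SemidirectProduct.inl (Multiplicative.ofAdd 1)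
  | some i => SemidirectProduct.inr (FreeGroup.of i)

/-- Edges of the Cayley graph of `B ⋊ A` over `W`. -/
def LiftedEdgeIn (p : Fin n → Nat.Primes) (W : Set (FreeGroup (Fin n))) (g g' : PrimeGroup p) :
    Prop :=
  g.right ∈ W ∧ g'.right ∈ W ∧ ∃ s, g' = g * gen p s

/-- Right multiplication by `a_i` leaves the `B`-coordinate alone, so paths in the tree lift at
constant `b`. -/
theorem eqvGen_liftedEdgeIn_of_edgeIn {W : Set (FreeGroup (Fin n))} {u v : FreeGroup (Fin n)}
    (h : Relation.EqvGen (EdgeIn W) u v) (b : Multiplicative (ZInv p)) :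
    Relation.EqvGen (LiftedEdgeIn p W) ⟨b, u⟩ ⟨b, v⟩ := by
  induction h with
  | rel u v h =>
    obtain ⟨hu, hv, i, rfl⟩ := h
    exact .rel _ _ ⟨hu, hv, some i, by ext <;> simp [gen]⟩
  | refl => exact .refl _
  | symm _ _ _ ih => exact .symm _ _ ih
  | trans _ _ _ _ _ h1 h2 => exact .trans _ _ _ h1 h2

/-- If the subgraph spanned by `W` is connected and contains points of arbitrarily large exponent
sum of every `a_i`, then its preimage in the Cayley graph of `B ⋊ A` is connected. -/
theorem eqvGen_liftedEdgeIn (hp : Function.Injective p) {W : Set (FreeGroup (Fin n))}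
    (hconn : ∀ u ∈ W, ∀ v ∈ W, Relation.EqvGen (EdgeIn W) u v)
    (hexp : ∀ (i : Fin n) (K : ℕ), ∃ w ∈ W, (K : ℤ) ≤ exponent i w) {g g' : PrimeGroup p}
    (hg : g.right ∈ W) (hg' : g'.right ∈ W) : Relation.EqvGen (LiftedEdgeIn p W) g g' := by
  obtain ⟨b, w⟩ := g
  obtain ⟨b', w'⟩ := g'
  refine .trans _ _ _ ?_ (eqvGen_liftedEdgeIn_of_edgeIn (hconn w hg w' hg') b')
  -- The changes of the `B`-coordinate achievable over `w`. Quantifying over all starting points `b`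
  -- makes them a subgroup.
  let S : AddSubgroup (ZInv p) :=
    { carrier := {x | ∀ b : ZInv p, Relation.EqvGen (LiftedEdgeIn p W)
        ⟨Multiplicative.ofAdd b, w⟩ ⟨Multiplicative.ofAdd (b + x), w⟩}
      zero_mem' := fun b => by rw [add_zero]; exact .refl _
      add_mem' := fun {x y} hx hy b => by
        rw [← add_assoc]; exact .trans _ _ _ (hx b) (hy (b + x))
      neg_mem' := fun {x} hx b => by
        have := hx (b + -x)
        rw [neg_add_cancel_right] at this
        exact .symm _ _ this }
  have hS : S = ⊤ := by
    refine eq_top_of_scaleElt_mem hp S ⟨w, hg⟩ (fun v hv b => ?_) hexp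
    -- Walk from `w` to `v`, cross the `B`-edge there, which adds `scaleElt p v`, and walk back.
    refine .trans _ _ _ (eqvGen_liftedEdgeIn_of_edgeIn (hconn w hg v hv) _) ?_
    refine .trans _ _ _ ?_ (eqvGen_liftedEdgeIn_of_edgeIn (hconn v hv w hg) _)
    refine .rel _ _ ⟨hv, hv, none, ?_⟩
    ext
    · simp [gen, scaleElt]
    · simp [gen]
  have : b'.toAdd - b.toAdd ∈ S := hS ▸ AddSubgroup.mem_top _
  simpa using this b.toAdd

end Paths

/-! ## The Cayley graph of `B ⋊ A` over the tree -/

section CayleyGraph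

variable {n : ℕ} {p : Fin n → Nat.Primes}

/-- The Cayley graph of `B ⋊ A` with respect to `1 ∈ B` and `a_1, …, a_n`. -/
def primeGroupGraph (hp : Function.Injective p) : FreeCocompactGraph (PrimeGroup p) where
  V := PrimeGroup p
  E := PrimeGroup p × Option (Fin n)
  src e := e.1
  tgt e := e.1 * gen p e.2
  actE :=
    { smul := fun g e => (g * e.1, e.2)
      one_smul := fun e => Prod.ext (one_mul _) rfl
      mul_smul := fun g g' e => Prod.ext (mul_assoc _ _ _) rfl }
  src_smul _ _ := rfl
  tgt_smul _ _ := mul_assoc _ _ _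
  free g v h := mul_eq_right.mp h
  finite_orbits_V := Finite.of_surjective (fun _ : Unit => Quotient.mk'' 1) fun x => by
    induction x using Quotient.inductionOn' with
    | h g => exact ⟨(), Quotient.sound' ⟨g⁻¹, inv_mul_cancel g⟩⟩
  finite_orbits_E := by
    let _ : MulAction (PrimeGroup p) (PrimeGroup p × Option (Fin n)) :=
      { smul := fun g e => (g * e.1, e.2)
        one_smul := fun e => Prod.ext (one_mul _) rfl
        mul_smul := fun g g' e => Prod.ext (mul_assoc _ _ _) rfl }
    refine Finite.of_surjective (fun s : Option (Fin n) => Quotient.mk'' (1, s)) fun x => ?_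
    induction x using Quotient.inductionOn' with
    | h e => exact ⟨e.2, Quotient.sound' ⟨e.1⁻¹, Prod.ext (inv_mul_cancel e.1) rfl⟩⟩
  nonempty := ⟨1⟩
  connected g g' := by
    have h := eqvGen_liftedEdgeIn hp (W := univ) (fun u _ v _ => by
      obtain ⟨q⟩ := (freeCayleyGraph_connected n).preconnected u v
      exact eqvGen_edgeIn_of_walk q fun _ _ => mem_univ _)
      (fun i K => ⟨FreeGroup.of i ^ K, mem_univ _, by simp⟩) (mem_univ g.right)
      (mem_univ g'.right)
    refine Relation.EqvGen.mono (fun g g' h => ?_) _ _ h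
    obtain ⟨-, -, s, rfl⟩ := h
    exact ⟨(g, s), rfl, rfl⟩

theorem right_mul_gen (g : PrimeGroup p) (s : Option (Fin n)) :
    g.right = (g * gen p s).right ∨ (freeCayleyGraph n).Adj g.right (g * gen p s).right := by
  cases s with
  | none => left; simp [gen]
  | some i => right; exact freeCayleyGraph_adj_mul_of _ i

open Realization in
/-- The `G`-map from the Cayley graph of `G = B ⋊ A` to the tree that is affine on edges. -/
noncomputable def primeGroupMap (hp : Function.Injective p) :
    EquivariantMap (rhoAction p) (primeGroupGraph hp) where
  vert g := vertex (freeCayleyGraph n) (SemidirectProduct.right g)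
  edge e := edgePath (right_mul_gen e.1 e.2)
  vert_smul _ _ := (map_leftTranslation_vertex _ _).symm
  edge_smul g e s := 
    (map_leftTranslation_edgePoint (g := g.right) rfl (mul_assoc _ _ _).symm (right_mul_gen e.1 e.2)
      (right_mul_gen (g * e.1) e.2) s).symm

/-- The vertices of a horoball span a connected subgraph. -/
theorem eqvGen_edgeIn_horoball (τ : CayleyBoundary n) (t : ℝ) {u v : FreeGroup (Fin n)}
    (hu : Realization.vertex _ u ∈ horoball τ.1 t) (hv : Realization.vertex _ v ∈ horoball τ.1 t) :
    Relation.EqvGen (EdgeIn {w | Realization.vertex _ w ∈ horoball τ.1 t}) u v := by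
  obtain ⟨m, hum, hvm⟩ := exists_nat_of_mem_horoball τ.2.1 hu hv
  obtain ⟨g, hg⟩ := exists_vertex_of_ray τ m
  have key : ∀ u : FreeGroup (Fin n),
      dist (Realization.vertex _ u : CayleyTree n) (τ.1 m) ≤ m - t →
      Relation.EqvGen (EdgeIn {w | Realization.vertex _ w ∈ horoball τ.1 t}) u g := by
    classical
    intro u hu
    obtain ⟨q, hq⟩ := (freeCayleyGraph_connected n).exists_walk_length_eq_dist u g
    -- A geodesic to the centre of a ball stays in the ball.
    refine eqvGen_edgeIn_of_walk q fun x hx => (mem_horoball_iff_nat τ.2.1).mpr ⟨m, ?_⟩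
    rw [hg, Realization.dist_vertex] at hu ⊢
    refine le_trans ?_ hu
    rw [← hq]
    exact_mod_cast (SimpleGraph.dist_le (q.dropUntil x hx)).trans
      (q.length_dropUntil_le_length hx)
  exact .trans _ _ _ (key u hum) (.symm _ _ (key v hvm))

/-- The witness leaves the ray at time `m` and takes `m - s` steps along `a_i`, with `s ≥ t`, so it
stays in the ball of radius `m - t`. -/
theorem exists_le_exponent_horoball (τ : CayleyBoundary n) {c : ℕ → Fin n × Bool}
    (hτ : RepresentedBy τ c) {i : Fin n} (hc : ∀ N, ∃ m ≥ N, c m ≠ (i, false)) (t : ℝ) (K : ℕ) :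
    ∃ w, Realization.vertex _ w ∈ horoball τ.1 t ∧ (K : ℤ) ≤ exponent i w := by
  obtain ⟨s, hs⟩ := exists_nat_ge t
  -- The extra `s` pays for taking only `m - s` steps instead of `m`.
  obtain ⟨l, hl⟩ := exists_le_exponent_prefix hc (K + s)
  set m := max l s
  have hm := hl m (le_max_left _ _)
  have hsm : s ≤ m := le_max_right _ _
  set g := FreeGroup.mk (List.ofFn fun j : Fin m => c j)
  refine ⟨g * FreeGroup.of i ^ (m - s), (mem_horoball_iff_nat τ.2.1).mpr ⟨m, ?_⟩, ?_⟩
  · have hpow : ∀ k : ℕ, (freeCayleyGraph n).dist (g * FreeGroup.of i ^ k) g ≤ k := by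
      intro k
      induction k with
      | zero => simp
      | succ k ih =>
        have hadj := freeCayleyGraph_adj_mul_of (g * FreeGroup.of i ^ k) i
        rw [mul_assoc, ← pow_succ] at hadj
        have h1 := SimpleGraph.dist_eq_one_iff_adj.mpr hadj.symm
        have h2 := (freeCayleyGraph_connected n).dist_triangle
          (u := g * FreeGroup.of i ^ (k + 1)) (v := g * FreeGroup.of i ^ k) (w := g)
        omega
    rw [hτ m, Realization.dist_vertex]
    have h1 : ((freeCayleyGraph n).dist (g * FreeGroup.of i ^ (m - s)) g : ℝ) ≤ (m - s : ℕ) := by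
      exact_mod_cast hpow (m - s)
    rw [Nat.cast_sub hsm] at h1
    linarith
  · rw [exponent_mul, exponent_pow, exponent_of, if_pos rfl, Nat.cast_sub hsm]
    push_cast at hm
    linarith

/-- The `G`-map of the Cayley graph is controlled connected, without any lag, over the end points
whose word is not eventually constant equal to some `a_i⁻¹`. -/
theorem controlledConnected_primeGroupMap (hp : Function.Injective p) (τ : CayleyBoundary n)
    {c : ℕ → Fin n × Bool} (hτ : RepresentedBy τ c)
    (hc : ∀ i N, ∃ m ≥ N, c m ≠ (i, false)) : (primeGroupMap hp).ControlledConnected τ.1 := by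
  refine ⟨fun _ => 0, fun _ => le_rfl, by simpa using! tendsto_id, fun t x hx y hy => ?_⟩
  rw [sub_zero]
  refine ⟨hx, hy, Relation.EqvGen.mono (fun g g' h => ?_) _ _ (eqvGen_liftedEdgeIn hp
    (W := {w | Realization.vertex _ w ∈ horoball τ.1 t})
    (fun u hu v hv => eqvGen_edgeIn_horoball τ t hu hv)
    (fun i K => exists_le_exponent_horoball τ hτ (hc i) t K) hx hy)⟩
  obtain ⟨hg, hg', s, rfl⟩ := h
  obtain ⟨m, h1, h2⟩ := exists_nat_of_mem_horoball τ.2.1 hg hg'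
  refine ⟨(g, s), ?_, rfl, rfl⟩
  exact fun r => (mem_horoball_iff_nat τ.2.1).mpr
    ⟨m, Realization.dist_edgePoint_le (right_mul_gen g s) r _ h1 h2⟩

end CayleyGraph

/-! ## End points over which no map is controlled connected -/

/-- An invariant function on a set with finitely many orbits is bounded above. -/
theorem exists_le_of_finite_orbits {G α : Type*} [Group G] [MulAction G α]
    [Finite (MulAction.orbitRel.Quotient G α)] {R : Type*} [LinearOrder R] [Nonempty R]
    (f : α → R) (hf : ∀ (g : G) x, f (g • x) = f x) : ∃ C, ∀ x, f x ≤ C := by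
  let f' : MulAction.orbitRel.Quotient G α → R := Quotient.lift f (by
    rintro _ x ⟨g, rfl⟩
    exact hf g x)
  obtain ⟨C, hC⟩ := (finite_range f').bddAbove
  exact ⟨C, fun x => hC ⟨Quotient.mk'' x, rfl⟩⟩

/-- A free `G`-graph has an equivariant map from its vertices to `G`. -/
theorem FreeCocompactGraph.exists_equivariant {G : Type*} [Group G] (X : FreeCocompactGraph G) :
    ∃ π : X.V → G, ∀ (g : G) (v : X.V), π (g • v) = g * π v := by
  -- With one representative per orbit, `π v` is the element carrying the representative to `v`;
  -- freeness makes it unique, hence equivariant.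
  let rep : X.V → X.V := fun v => Quotient.out (Quotient.mk'' v : MulAction.orbitRel.Quotient G X.V)
  have hrep : ∀ v, ∃ g : G, g • rep v = v := fun v =>
    (MulAction.orbitRel G X.V).symm (Quotient.mk_out (s := MulAction.orbitRel G X.V) v)
  have hsmul : ∀ (g : G) (v : X.V), rep (g • v) = rep v := fun g v =>
    congrArg Quotient.out (Quotient.sound' ⟨g, rfl⟩)
  choose π hπ using hrep
  refine ⟨π, fun g v => ?_⟩
  have h1 := hπ (g • v)
  rw [hsmul] at h1
  have h2 : ((π v)⁻¹ * g⁻¹ * π (g • v)) • rep v = rep v := by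
    rw [mul_smul, h1, mul_smul, inv_smul_smul, inv_smul_eq_iff, hπ]
  have h3 := X.free _ _ h2
  rwa [mul_assoc, inv_mul_eq_one, eq_inv_mul_iff_mul_eq, eq_comm] at h3

section NotControlled

variable {n : ℕ} {p : Fin n → Nat.Primes}

theorem eval_exponent_rhoAction (i : Fin n) (g : PrimeGroup p) (x : CayleyTree n) :
    Realization.eval (fun w => (exponent i w : ℝ)) (rhoAction p g x) =
      exponent i g.right + Realization.eval (fun w => (exponent i w : ℝ)) x := by
  have h := Realization.eval_map (leftTranslation g.right) (fun w => (exponent i w : ℝ)) x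
  have h2 := Realization.eval_sub_const (fun w => (exponent i w : ℝ)) (-exponent i g.right) x
  rw [show rhoAction p g x = Realization.map (leftTranslation g.right) x from rfl, h, add_comm,
    ← sub_neg_eq_add, ← h2]
  congr 1
  funext w
  show ((exponent i (g.right * w) : ℤ) : ℝ) = _
  rw [exponent_mul]; push_cast; ring

/-- On a horoball at an end point whose word is eventually `a_i⁻¹`, the exponent sum of `a_i` is
bounded above. -/
theorem eval_exponent_le_of_mem_horoball (τ : CayleyBoundary n) {c : ℕ → Fin n × Bool}
    (hτ : RepresentedBy τ c) {i : Fin n} {N : ℕ} (hc : ∀ m ≥ N, c m = (i, false)) (t : ℝ) :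
    ∃ C : ℝ, ∀ x ∈ horoball τ.1 t,
      Realization.eval (fun w => (exponent i w : ℝ)) x ≤ C := by
  obtain ⟨C, hC⟩ := exponent_prefix_of_eventually hc
  refine ⟨C - t, fun x hx => ?_⟩
  obtain ⟨k, hk⟩ := (mem_horoball_iff_nat τ.2.1).mp hx
  -- Enlarging the ball puts its centre on the part of the ray where the exponent sum is `C - m`;
  -- the radius `m - t` then cancels `m`.
  have hm : dist x (τ.1 ((max k N : ℕ) : ℝ≥0)) ≤ ((max k N : ℕ) : ℝ) - t := by
    simpa using mem_horoball_of_dist_le (l := k) (l' := (max k N : ℕ)) τ.2.1 (by simp)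
      (by simpa using hk)
  have h1 := Realization.eval_sub_eval_le_dist _ (exponent_lipschitz i) x
    (τ.1 ((max k N : ℕ) : ℝ≥0))
  have h2 : Realization.eval (fun w => (exponent i w : ℝ)) (τ.1 ((max k N : ℕ) : ℝ≥0)) =
      C - ((max k N : ℕ) : ℝ) := by
    rw [hτ, Realization.eval_vertex, hC _ (le_max_right _ _)]; push_cast; ring
  linarith

/-- No map to the tree is controlled connected over an end point whose word is eventually constant
equal to `a_i⁻¹`. -/
theorem not_controlledConnected (hp : Function.Injective p) (τ : CayleyBoundary n)
    {c : ℕ → Fin n × Bool} (hτ : RepresentedBy τ c) {i : Fin n} {N : ℕ}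
    (hc : ∀ m ≥ N, c m = (i, false)) {X : FreeCocompactGraph (PrimeGroup p)}
    (h : EquivariantMap (rhoAction p) X) : ¬ h.ControlledConnected τ.1 := by
  rintro ⟨lag, -, -, hlag⟩
  have : Fact (p i : ℕ).Prime := ⟨(p i).2⟩
  have hp1 : (1 : ℚ) < (p i : ℕ) := by exact_mod_cast (p i).2.one_lt
  have := X.finite_orbits_V
  have := X.finite_orbits_E
  obtain ⟨π, hπ⟩ := X.exists_equivariant
  obtain ⟨v⟩ := X.nonempty
  -- The level at which the ball about the base point of the ray just reaches `h.vert v`.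
  set t : ℝ := -dist (h.vert v) (τ.1 0)
  have hv : v ∈ h.subV τ.1 t :=
    (mem_horoball_iff_nat τ.2.1).mpr ⟨0, by simp [t]⟩
  obtain ⟨C, hC⟩ := eval_exponent_le_of_mem_horoball τ hτ hc (t - lag t)
  set ex := Realization.eval (Γ := freeCayleyGraph n) (fun w => (exponent i w : ℝ))
  -- Both terms change by the exponent sum of `g` under translation by `g`, so their difference is
  -- invariant, and a bound over the horoball passes from `h` to `π`.
  obtain ⟨D, hD⟩ := exists_le_of_finite_orbits (G := PrimeGroup p)
    (fun x : X.V => (exponent i (π x).right : ℝ) - ex (h.vert x)) (fun g x => by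
      simp only [ex]
      rw [h.vert_smul, eval_exponent_rhoAction, hπ, SemidirectProduct.mul_right, exponent_mul]
      push_cast; ring)
  -- The label `π(src)⁻¹ π(tgt)` of an edge is invariant, so only finitely many occur.
  obtain ⟨F, hF⟩ := exists_le_of_finite_orbits (G := PrimeGroup p)
    (fun e : X.E => padicNorm (p i) (((π (X.src e))⁻¹ * π (X.tgt e)).left.toAdd : ZInv p))
    (fun g e => by rw [X.src_smul, X.tgt_smul, hπ, hπ]; group)
  obtain ⟨K, hK⟩ := exists_nat_ge (C + D)
  set B : ℚ := ((p i : ℕ) : ℚ) ^ K * max F 0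
  have hedge : ∀ e ∈ h.subE τ.1 (t - lag t), padicNorm (p i)
      (((π (X.tgt e)).left.toAdd : ZInv p) - ((π (X.src e)).left.toAdd : ZInv p) : ℚ) ≤ B := by
    intro e he
    have h1 : h.vert (X.src e) ∈ horoball τ.1 (t - lag t) := by
      have := he 0
      rwa [Path.source] at this
    have h2 : exponent i (π (X.src e)).right ≤ (K : ℤ) := by
      have := hC _ h1
      have := hD (X.src e)
      have : (exponent i (π (X.src e)).right : ℝ) ≤ K := by linarith
      exact_mod_cast this
    set f := (π (X.src e))⁻¹ * π (X.tgt e) with hf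
    have h3 : π (X.tgt e) = π (X.src e) * f := by rw [hf, mul_inv_cancel_left]
    -- Crossing an edge adds the `B`-part of its label, scaled by the tree coordinate of the source.
    have h4 : (((π (X.tgt e)).left.toAdd : ZInv p) - ((π (X.src e)).left.toAdd : ZInv p) : ℚ) =
        scale p (π (X.src e)).right * (f.left.toAdd : ZInv p) := by
      rw [h3, SemidirectProduct.mul_left, toAdd_mul, ← coe_primeAction]
      push_cast; ring
    rw [h4, padicNorm.mul, padicNorm_scale hp]
    refine mul_le_mul ?_ ((hF e).trans (le_max_left _ _)) (padicNorm.nonneg _) (by positivity)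
    rw [← zpow_natCast]
    exact zpow_le_zpow_right₀ hp1.le h2
  have hB : 0 ≤ B := by positivity
  have hpath : ∀ x y : X.V, Relation.EqvGen
      (fun v w => ∃ e ∈ h.subE τ.1 (t - lag t), X.src e = v ∧ X.tgt e = w) x y →
      padicNorm (p i) (((π y).left.toAdd : ZInv p) - ((π x).left.toAdd : ZInv p) : ℚ) ≤ B := by
    intro x y hxy
    induction hxy with
    | rel x y hxy => obtain ⟨e, he, rfl, rfl⟩ := hxy; exact hedge e he
    | refl x => simpa using hB
    | symm x y _ ih => rwa [← padicNorm.neg, neg_sub]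
    | trans x y z _ _ h1 h2 =>
      -- The ultrametric inequality keeps the bound independent of the length of the path.
      rw [← sub_add_sub_cancel _ (((π y).left.toAdd : ZInv p) : ℚ) _]
      exact padicNorm.nonarchimedean.trans (max_le h2 h1)
  obtain ⟨k, hk⟩ := pow_unbounded_of_one_lt B hp1
  -- The element `p_i⁻ᵏ`, of `p_i`-adic norm `p_iᵏ > B`; it fixes the tree but moves `v` too far in
  -- the `B`-direction.
  let b : ZInv p := ⟨1 / ((p i : ℕ) : ℚ), inv_mem_ZInv p i⟩ ^ k
  let g : PrimeGroup p := SemidirectProduct.inl (Multiplicative.ofAdd b)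
  have hgv : g • v ∈ h.subV τ.1 t := by
    have : h.vert (g • v) = h.vert v := by
      rw [h.vert_smul]
      exact map_leftTranslation_one _
    show h.vert (g • v) ∈ horoball τ.1 t
    rw [this]; exact hv
  have hle := hpath _ _ (hlag t v hv (g • v) hgv).2.2
  have hb : (((π (g • v)).left.toAdd : ZInv p) - ((π v).left.toAdd : ZInv p) : ℚ) =
      (((p i : ℕ) : ℚ) ^ k)⁻¹ := by
    rw [hπ, SemidirectProduct.mul_left, toAdd_mul]
    simp [g, b]
  have hnorm : padicNorm (p i) (((p i : ℕ) : ℚ) ^ k) = (((p i : ℕ) : ℚ) ^ k)⁻¹ := by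
    rw [padicNorm.eq_zpow_of_nonzero (by positivity)]
    simp
  rw [hb, inv_eq_one_div, padicNorm.div, padicNorm.one, hnorm, one_div, inv_inv] at hle
  exact absurd hle (not_le.mpr hk)

end NotControlled

theorem mainTheorem8 (n : ℕ) (p : Fin n → Nat.Primes) (hp : Function.Injective p) :
    Sigma1 (rhoAction p) (Realization.vertex (freeCayleyGraph n) 1) =
      {τ : CayleyBoundary n | ¬ ∃ c : ℕ → Fin n × Bool, RepresentedBy τ c ∧
        ∃ (i : Fin n) (N : ℕ), ∀ m ≥ N, c m = (i, false)} := by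
  ext τ
  constructor
  · rintro ⟨X, h, hcc⟩ ⟨c, hτ, i, N, hc⟩
    exact not_controlledConnected hp τ hτ hc h hcc
  · intro hτ
    obtain ⟨c, hc⟩ := exists_representedBy τ
    refine ⟨primeGroupGraph hp, primeGroupMap hp, controlledConnected_primeGroupMap hp τ hc ?_⟩
    intro i N
    by_contra! hN
    exact hτ ⟨c, hc, i, N, hN⟩
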